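/- For a finite family of points $u_1,\dots,u_M$ in $\mathbb R^n$ put $$P(u_1,\dots,u_M)=\int_{\mathbb R^n}\max_{1\le i\le M} e^{-|x-u_i|^2}\,dx ,$$ where $|\cdot|$ is the Euclidean norm. Let $N\le n$ and let $r_1,\dots,r_N\ge 0$ be real numbers. Among all families $v_1,\dots,v_N$ of vectors in $\mathbb R^n$ with $|v_i|=r_i$ for all $i$, the (finite) value $$P(v_1,-v_1,\dots,v_N,-v_N)$$ is maximized when the $v_i$ are pairwise orthogonal. That is, there are pairwise orthogonal $w_1,\dots,w_N\in\mathbb R^n$ with $|w_i|=r_i$, and for every such orthogonal family and every family $v_1,\dots,v_N\in\mathbb R^n$ with $|v_i|=r_i$, $$P(v_1,-v_1,\dots,v_N,-v_N)\le P(w_1,-w_1,\dots,w_N,-w_N).$$ -/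

import Mathlib

open MeasureTheory

noncomputable section

/-- The function `x ↦ max_i exp (-|x - u i|²)` of a family `u` of points of `ℝⁿ`.
For a finite nonempty index type the supremum is a maximum. -/
def maxGauss {n : ℕ} {ι : Type*} (u : ι → EuclideanSpace ℝ (Fin n))
    (x : EuclideanSpace ℝ (Fin n)) : ℝ :=
  ⨆ i, Real.exp (-‖x - u i‖ ^ 2)

/-- The functional `P(u) = ∫_{ℝⁿ} max_i exp (-|x - u i|²) dx`. -/
def codeP {n : ℕ} {ι : Type*} (u : ι → EuclideanSpace ℝ (Fin n)) : ℝ :=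
  ∫ x, maxGauss u x

/-- The antipodal family `v₁, …, v_N, -v₁, …, -v_N`. -/
def antipodal {n N : ℕ} (v : Fin N → EuclideanSpace ℝ (Fin n)) :
    Fin N ⊕ Fin N → EuclideanSpace ℝ (Fin n) :=
  Sum.elim v (fun i => -v i)

/-- The families `v₁, …, v_N` of vectors of `ℝⁿ` with prescribed lengths `|v i| = r i`. -/
def prescribedLengths (n : ℕ) {N : ℕ} (r : Fin N → ℝ) :
    Set (Fin N → EuclideanSpace ℝ (Fin n)) :=
  {v | ∀ i, ‖v i‖ = r i}

/-- The members of the family are orthogonal to each other (zero vectors are allowed). -/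
def PairwiseOrthogonal {n N : ℕ} (v : Fin N → EuclideanSpace ℝ (Fin n)) : Prop :=
  Pairwise fun i j => inner ℝ (v i) (v j) = 0

end

open ProbabilityTheory Set
open scoped ENNReal Pointwise

/-! Factor `exp (-|x|²)` out of the integrand. By the layer-cake formula, `P` is a constant times
the integral over `t > 0` of the Gaussian measure of `{x | max_i exp (2⟨u_i, x⟩ - |u_i|²) > t}`. For
an antipodal family the complement of this set is the intersection of the slabs `|⟨v_i, x⟩| ≤ (log t
+ |v_i|²) / 2`, whose half-widths depend only on the lengths. It therefore suffices that orthogonal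
normals minimize the Gaussian measure of such an intersection.

The measure of one slab depends only on the length of its normal, and orthogonal normals give
independent slabs, hence a product. Šidák's inequality bounds the intersection below by the same
product in general. It follows by induction from the positive correlation of a slab with a symmetric
convex set `K`: the Gaussian measure of the section of `K` at height `t` is even in `t` and, by
Prékopa–Leindler, decreases with `|t|`, so conditioning on `|t| ≤ c` can only raise its mean.

Prékopa–Leindler is proved on the line by applying Brunn–Minkowski to superlevel sets, then for
Gaussian products by induction on dimension. -/

/-! ### The Prékopa–Leindler inequality -/

/-- The one-dimensional Brunn–Minkowski inequality for compact sets. -/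
theorem volume_add_le_of_isCompact {A B C : Set ℝ} {a b : ℝ} (ha : 0 < a) (hb : 0 < b)
    (hA : IsCompact A) (hB : IsCompact B) (hA' : A.Nonempty) (hB' : B.Nonempty)
    (hC : ∀ x ∈ A, ∀ y ∈ B, a * x + b * y ∈ C) :
    ENNReal.ofReal a * volume A + ENNReal.ofReal b * volume B ≤ volume C := by
  obtain ⟨α, hαA, hα⟩ := hA.exists_isGreatest hA'
  obtain ⟨β, hβB, hβ⟩ := hB.exists_isLeast hB'
  have h1 : volume ((b * β) +ᵥ (a • A)) = ENNReal.ofReal a * volume A := by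
    rw [measure_vadd, Measure.addHaar_smul]; simp [abs_of_pos ha]
  have h2 : volume ((a * α) +ᵥ (b • B)) = ENNReal.ofReal b * volume B := by
    rw [measure_vadd, Measure.addHaar_smul]; simp [abs_of_pos hb]
  have hm : MeasurableSet ((a * α) +ᵥ (b • B)) :=
    ((hB.smul b).vadd (a * α)).measurableSet
  -- Since `α = max A` and `β = min B`, the two translates lie on opposite sides of `a * α + b * β`.
  have hd : AEDisjoint volume ((b * β) +ᵥ (a • A)) ((a * α) +ᵥ (b • B)) := by
    refine measure_mono_null (t := {a * α + b * β}) ?_ (by simp)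
    rintro z ⟨⟨_, ⟨x, hx, rfl⟩, rfl⟩, ⟨_, ⟨y, hy, rfl⟩, h⟩⟩
    simp only [vadd_eq_add, smul_eq_mul, mem_singleton_iff] at h ⊢
    nlinarith [mul_le_mul_of_nonneg_left (hα hx) ha.le, mul_le_mul_of_nonneg_left (hβ hy) hb.le]
  rw [← h1, ← h2, ← measure_union₀ hm.nullMeasurableSet hd]
  refine measure_mono (union_subset ?_ ?_)
  · rintro z ⟨_, ⟨x, hx, rfl⟩, rfl⟩
    simpa [add_comm] using hC x hx β hβB
  · rintro z ⟨_, ⟨y, hy, rfl⟩, rfl⟩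
    simpa using hC α hαA y hy

/-- The one-dimensional Brunn–Minkowski inequality. -/
theorem volume_add_le {A B C : Set ℝ} {a b : ℝ} (ha : 0 < a) (hb : 0 < b)
    (hA : MeasurableSet A) (hB : MeasurableSet B) (hA' : A.Nonempty) (hB' : B.Nonempty)
    (hC : ∀ x ∈ A, ∀ y ∈ B, a * x + b * y ∈ C) :
    ENNReal.ofReal a * volume A + ENNReal.ofReal b * volume B ≤ volume C := by
  obtain ⟨x₀, hx₀⟩ := hA'
  obtain ⟨y₀, hy₀⟩ := hB'
  have inner : ∀ {S : Set ℝ}, MeasurableSet S →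
      volume S = ⨆ K : {K : Set ℝ // K ⊆ S ∧ IsCompact K}, volume (K : Set ℝ) := fun hS => by
    rw [hS.measure_eq_iSup_isCompact, iSup_subtype]
    simp only [iSup_and]
  have : Nonempty {K : Set ℝ // K ⊆ A ∧ IsCompact K} := ⟨∅, empty_subset _, isCompact_empty⟩
  have : Nonempty {K : Set ℝ // K ⊆ B ∧ IsCompact K} := ⟨∅, empty_subset _, isCompact_empty⟩
  rw [inner hA, inner hB, ENNReal.mul_iSup, ENNReal.mul_iSup]
  refine ENNReal.iSup_add_iSup_le fun ⟨K, hK⟩ ⟨L, hL⟩ => ?_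
  -- The approximating compact sets may be empty; adding `x₀` and `y₀` makes them nonempty.
  refine le_trans ?_ (volume_add_le_of_isCompact (A := insert x₀ K) (B := insert y₀ L) ha hb
    (hK.2.insert _) (hL.2.insert _) (insert_nonempty _ _) (insert_nonempty _ _) fun x hx y hy =>
      hC x (insert_subset hx₀ hK.1 hx) y (insert_subset hy₀ hL.1 hy))
  gcongr <;> exact subset_insert _ _

theorem ENNReal.geom_mean_le_arith_mean2 {a b : ℝ} (ha : 0 < a) (hb : 0 < b) (hab : a + b = 1)
    (p q : ℝ≥0∞) :
    p ^ a * q ^ b ≤ ENNReal.ofReal a * p + ENNReal.ofReal b * q := by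
  rcases eq_or_ne p ⊤ with rfl | hp
  · simp [ENNReal.mul_top, ha]
  rcases eq_or_ne q ⊤ with rfl | hq
  · simp [ENNReal.mul_top, hb]
  lift p to NNReal using hp
  lift q to NNReal using hq
  have h := NNReal.geom_mean_le_arith_mean2_weighted ⟨a, ha.le⟩ ⟨b, hb.le⟩ p q
    (NNReal.eq hab)
  rw [← ENNReal.coe_rpow_of_nonneg _ ha.le, ← ENNReal.coe_rpow_of_nonneg _ hb.le]
  rw [ENNReal.ofReal_eq_coe_nnreal ha.le, ENNReal.ofReal_eq_coe_nnreal hb.le]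
  exact_mod_cast h

/-- The bound by one keeps values finite, so the real layer-cake formula applies. -/
theorem lintegral_eq_lintegral_superlevel (μ : Measure ℝ) {f : ℝ → ℝ≥0∞} (hf : Measurable f)
    (hf1 : ∀ x, f x ≤ 1) :
    ∫⁻ x, f x ∂μ = ∫⁻ t in Ioi (0 : ℝ), μ {x | ENNReal.ofReal t < f x} := by
  have hfin : ∀ x, f x ≠ ⊤ := fun x => ((hf1 x).trans_lt ENNReal.one_lt_top).ne
  have h := lintegral_eq_lintegral_meas_lt μ (f := fun x => (f x).toReal)
    (Filter.Eventually.of_forall fun x => ENNReal.toReal_nonneg) hf.ennreal_toReal.aemeasurable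
  simp only [ENNReal.ofReal_toReal (hfin _)] at h
  rw [h]
  refine setLIntegral_congr_fun measurableSet_Ioi fun t ht => ?_
  simp only [ENNReal.ofReal_lt_iff_lt_toReal (mem_Ioi.1 ht).le (hfin _)]

/-- The Prékopa–Leindler inequality on the line for functions whose supremum is one. -/
theorem lintegral_add_le_of_iSup_eq_one {f g h : ℝ → ℝ≥0∞} {a b : ℝ} (ha : 0 < a) (hb : 0 < b)
    (hab : a + b = 1) (hf : Measurable f) (hg : Measurable g) (hh : Measurable h)
    (hf1 : ⨆ x, f x = 1) (hg1 : ⨆ x, g x = 1)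
    (H : ∀ x y, f x ^ a * g y ^ b ≤ h (a * x + b * y)) :
    ENNReal.ofReal a * (∫⁻ x, f x) + ENNReal.ofReal b * (∫⁻ x, g x) ≤ ∫⁻ x, h x := by
  have hfle : ∀ x, f x ≤ 1 := fun x => hf1 ▸ le_iSup f x
  have hgle : ∀ x, g x ≤ 1 := fun x => hg1 ▸ le_iSup g x
  -- Nothing bounds `h`, so it is truncated at one; only levels `t < 1` contribute for `f` and `g`.
  have hle : ∫⁻ x, min (h x) 1 ≤ ∫⁻ x, h x := lintegral_mono fun x => min_le_left _ _
  refine le_trans ?_ hle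
  rw [lintegral_eq_lintegral_superlevel _ hf hfle, lintegral_eq_lintegral_superlevel _ hg hgle,
    lintegral_eq_lintegral_superlevel _ (hh.min measurable_const) fun x => min_le_right _ _,
    ← lintegral_const_mul' _ _ ENNReal.ofReal_ne_top,
    ← lintegral_const_mul' _ _ ENNReal.ofReal_ne_top, ← lintegral_add_left]
  swap
  · refine Measurable.const_mul (Antitone.measurable fun s t hst => measure_mono fun x hx => ?_) _
    exact (ENNReal.ofReal_le_ofReal hst).trans_lt hx
  refine setLIntegral_mono' measurableSet_Ioi fun t ht => ?_
  rcases lt_or_ge t 1 with ht1 | ht1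
  · have ht1' : ENNReal.ofReal t < 1 := by simpa using ht1
    refine volume_add_le ha hb (measurableSet_lt measurable_const hf)
      (measurableSet_lt measurable_const hg) (show ∃ x, _ from lt_iSup_iff.1 (hf1 ▸ ht1'))
      (show ∃ x, _ from lt_iSup_iff.1 (hg1 ▸ ht1')) fun x hx y hy => ?_
    refine lt_min (lt_of_lt_of_le ?_ (H x y)) ht1'
    calc ENNReal.ofReal t = ENNReal.ofReal t ^ a * ENNReal.ofReal t ^ b := by
          rw [← ENNReal.rpow_add _ _ (by simpa using ht) ENNReal.ofReal_ne_top, hab,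
            ENNReal.rpow_one]
      _ < f x ^ a * g y ^ b := ENNReal.mul_lt_mul (ENNReal.rpow_lt_rpow hx ha)
            (ENNReal.rpow_lt_rpow hy hb)
  · have hE : ∀ {k : ℝ → ℝ≥0∞}, (∀ x, k x ≤ 1) → {x | ENNReal.ofReal t < k x} = ∅ := by
      intro k hk
      refine eq_empty_of_forall_notMem fun x hx => ?_
      exact absurd ((hk x).trans (by simpa using ht1)) (not_le.2 hx)
    simp [hE hfle, hE hgle]

/-- The Prékopa–Leindler inequality on the line, for bounded functions. -/
theorem prekopa_leindler_real {f g h : ℝ → ℝ≥0∞} {a b : ℝ} (ha : 0 < a) (hb : 0 < b)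
    (hab : a + b = 1) (hf : Measurable f) (hg : Measurable g) (hh : Measurable h)
    (hf1 : ⨆ x, f x ≠ ⊤) (hg1 : ⨆ x, g x ≠ ⊤)
    (H : ∀ x y, f x ^ a * g y ^ b ≤ h (a * x + b * y)) :
    (∫⁻ x, f x) ^ a * (∫⁻ x, g x) ^ b ≤ ∫⁻ x, h x := by
  set M := ⨆ x, f x with hM
  set L := ⨆ x, g x with hL
  rcases eq_or_ne M 0 with hM0 | hM0
  · have : ∀ x, f x = 0 := fun x => le_antisymm (hM0 ▸ le_iSup f x) zero_le
    simp [this, ha]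
  rcases eq_or_ne L 0 with hL0 | hL0
  · have : ∀ x, g x = 0 := fun x => le_antisymm (hL0 ▸ le_iSup g x) zero_le
    simp [this, hb]
  set D := (M ^ a * L ^ b)⁻¹ with hD
  have hMa : M ^ a ≠ 0 ∧ M ^ a ≠ ⊤ := by simp [hM0, hf1, ha]
  have hLb : L ^ b ≠ 0 ∧ L ^ b ≠ ⊤ := by simp [hL0, hg1, hb]
  have hDeq : ∀ p q : ℝ≥0∞, (M⁻¹ * p) ^ a * (L⁻¹ * q) ^ b = D * (p ^ a * q ^ b) := by
    intro p q
    rw [ENNReal.mul_rpow_of_nonneg _ _ ha.le, ENNReal.mul_rpow_of_nonneg _ _ hb.le,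
      ENNReal.inv_rpow, ENNReal.inv_rpow, hD, ENNReal.mul_inv (.inl hMa.1) (.inl hMa.2)]
    ring
  have key := lintegral_add_le_of_iSup_eq_one (f := fun x => M⁻¹ * f x) (g := fun x => L⁻¹ * g x)
    (h := fun x => D * h x) ha hb hab (hf.const_mul _) (hg.const_mul _) (hh.const_mul _)
    (by rw [← ENNReal.mul_iSup, ← hM, ENNReal.inv_mul_cancel hM0 hf1])
    (by rw [← ENNReal.mul_iSup, ← hL, ENNReal.inv_mul_cancel hL0 hg1])
    (fun x y => by rw [hDeq]; gcongr; exact H x y)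
  have key2 := (ENNReal.geom_mean_le_arith_mean2 ha hb hab _ _).trans key
  rw [lintegral_const_mul _ hf, lintegral_const_mul _ hg, lintegral_const_mul _ hh, hDeq] at key2
  refine (ENNReal.mul_le_mul_iff_right ?_ ?_).1 key2
  · simp [hD, ENNReal.mul_eq_top, hMa, hLb]
  · simp [hD, hMa, hLb]

/-- The Prékopa–Leindler inequality for the standard Gaussian measure on the line. -/
theorem prekopa_leindler_gaussianReal {f g h : ℝ → ℝ≥0∞} {a b : ℝ} (ha : 0 < a) (hb : 0 < b)
    (hab : a + b = 1) (hf : Measurable f) (hg : Measurable g) (hh : Measurable h)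
    (hf1 : ∀ x, f x ≤ 1) (hg1 : ∀ x, g x ≤ 1)
    (H : ∀ x y, f x ^ a * g y ^ b ≤ h (a * x + b * y)) :
    (∫⁻ x, f x ∂gaussianReal 0 1) ^ a * (∫⁻ x, g x ∂gaussianReal 0 1) ^ b ≤
      ∫⁻ x, h x ∂gaussianReal 0 1 := by
  set p := gaussianPDF 0 1 with hp
  have hpm : Measurable p := measurable_gaussianPDF 0 1
  have hpb : ∀ x, p x ≤ ENNReal.ofReal (√(2 * Real.pi))⁻¹ := by
    intro x
    rw [hp, gaussianPDF, gaussianPDFReal]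
    refine ENNReal.ofReal_le_ofReal ?_
    have : Real.exp (-(x - 0) ^ 2 / (2 * ((1 : NNReal) : ℝ))) ≤ 1 :=
      Real.exp_le_one_iff.2 (div_nonpos_of_nonpos_of_nonneg (by nlinarith [sq_nonneg x]) (by simp))
    simpa using mul_le_mul_of_nonneg_left this (by positivity : 0 ≤ (√(2 * Real.pi))⁻¹)
  have hpl : ∀ x y, p x ^ a * p y ^ b ≤ p (a * x + b * y) := by
    intro x y
    simp only [hp, gaussianPDF, gaussianPDFReal, sub_zero, NNReal.coe_one, mul_one]
    rw [ENNReal.ofReal_rpow_of_nonneg (by positivity) ha.le,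
      ENNReal.ofReal_rpow_of_nonneg (by positivity) hb.le, ← ENNReal.ofReal_mul (by positivity)]
    refine ENNReal.ofReal_le_ofReal ?_
    rw [Real.mul_rpow (by positivity) (by positivity), Real.mul_rpow (by positivity) (by positivity),
      ← Real.exp_mul, ← Real.exp_mul, mul_mul_mul_comm,
      ← Real.rpow_add (by positivity), hab, Real.rpow_one, ← Real.exp_add]
    gcongr
    obtain rfl : b = 1 - a := by linarith
    -- Uses `a x² + b y² - (a x + b y)² = a b (x - y)²`.
    nlinarith [mul_nonneg (mul_nonneg ha.le hb.le) (sq_nonneg (x - y))]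
  have hw : ∀ {k : ℝ → ℝ≥0∞}, Measurable k →
      ∫⁻ x, k x ∂gaussianReal 0 1 = ∫⁻ x, p x * k x := fun hk => by
    rw [gaussianReal_of_var_ne_zero 0 one_ne_zero, lintegral_withDensity_eq_lintegral_mul _ hpm hk]
    rfl
  have hbd : ∀ {k : ℝ → ℝ≥0∞}, (∀ x, k x ≤ 1) → ⨆ x, p x * k x ≠ ⊤ := fun hk =>
    ne_top_of_le_ne_top (b := ENNReal.ofReal (√(2 * Real.pi))⁻¹ * 1)
      (ENNReal.mul_ne_top ENNReal.ofReal_ne_top ENNReal.one_ne_top)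
      (iSup_le fun x => mul_le_mul' (hpb x) (hk x))
  rw [hw hf, hw hg, hw hh]
  refine prekopa_leindler_real ha hb hab (hpm.mul hf) (hpm.mul hg) (hpm.mul hh) (hbd hf1) (hbd hg1)
    fun x y => ?_
  rw [ENNReal.mul_rpow_of_nonneg _ _ ha.le, ENNReal.mul_rpow_of_nonneg _ _ hb.le, mul_mul_mul_comm]
  exact mul_le_mul' (hpl x y) (H x y)

/-- The Prékopa–Leindler inequality for products of standard Gaussian measures. -/
theorem prekopa_leindler_pi {m : ℕ} {f g h : (Fin m → ℝ) → ℝ≥0∞} {a b : ℝ} (ha : 0 < a)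
    (hb : 0 < b) (hab : a + b = 1) (hf : Measurable f) (hg : Measurable g) (hh : Measurable h)
    (hf1 : ∀ x, f x ≤ 1) (hg1 : ∀ x, g x ≤ 1)
    (H : ∀ x y, f x ^ a * g y ^ b ≤ h (a • x + b • y)) :
    (∫⁻ x, f x ∂Measure.pi fun _ => gaussianReal 0 1) ^ a *
      (∫⁻ x, g x ∂Measure.pi fun _ => gaussianReal 0 1) ^ b ≤
      ∫⁻ x, h x ∂Measure.pi fun _ => gaussianReal 0 1 := by
  induction m with
  | zero =>
    have h0 : ∀ k : (Fin 0 → ℝ) → ℝ≥0∞,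
        ∫⁻ x, k x ∂(Measure.pi fun _ => gaussianReal 0 1) = k 0 := fun k => by
      rw [Measure.pi_of_empty _ 0, lintegral_dirac]
    simpa [h0] using H 0 0
  | succ m ih =>
    have hmp := (measurePreserving_piFinSuccAbove
      (fun _ : Fin (m + 1) => gaussianReal 0 1) 0).symm
    have hsplit : ∀ {k : (Fin (m + 1) → ℝ) → ℝ≥0∞}, Measurable k →
        ∫⁻ x, k x ∂(Measure.pi fun _ => gaussianReal 0 1) =
          ∫⁻ s, ∫⁻ y, k (Fin.cons s y) ∂(Measure.pi fun _ => gaussianReal 0 1)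
            ∂gaussianReal 0 1 := by
      intro k hk
      rw [← hmp.lintegral_comp hk, lintegral_prod]
      · simp [MeasurableEquiv.piFinSuccAbove]; rfl
      · exact (hk.comp (MeasurableEquiv.measurable _)).aemeasurable
    have hcons : Measurable fun z : ℝ × (Fin m → ℝ) => (Fin.cons z.1 z.2 : Fin (m + 1) → ℝ) := by
      refine measurable_pi_iff.2 fun i => ?_
      refine Fin.cases ?_ (fun j => ?_) i
      · simpa using measurable_fst
      · simp only [Fin.cons_succ]; fun_prop
    have hmeas : ∀ {k : (Fin (m + 1) → ℝ) → ℝ≥0∞}, Measurable k →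
        Measurable fun s => ∫⁻ y, k (Fin.cons s y) ∂(Measure.pi fun _ : Fin m => gaussianReal 0 1) :=
      fun hk => (hk.comp hcons).lintegral_prod_right'
    have hle : ∀ {k : (Fin (m + 1) → ℝ) → ℝ≥0∞}, (∀ x, k x ≤ 1) → ∀ s,
        ∫⁻ y, k (Fin.cons s y) ∂(Measure.pi fun _ : Fin m => gaussianReal 0 1) ≤ 1 := fun hk s =>
      (lintegral_mono fun y => hk _).trans (by simp)
    rw [hsplit hf, hsplit hg, hsplit hh]
    -- The induction hypothesis on the fibres over `s` and `t` is the pointwise hypothesis for the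
    -- fibre integrals.
    refine prekopa_leindler_gaussianReal ha hb hab (hmeas hf) (hmeas hg) (hmeas hh) (hle hf1)
      (hle hg1) fun s t => ?_
    have hc : ∀ s, Measurable fun y : Fin m → ℝ => (Fin.cons s y : Fin (m + 1) → ℝ) := fun s =>
      hcons.comp (measurable_const.prodMk measurable_id)
    refine ih (hf.comp (hc s)) (hg.comp (hc t)) (hh.comp (hc _)) (fun y => hf1 _) (fun y => hg1 _)
      fun x y => ?_
    refine (H _ _).trans (le_of_eq (congrArg h ?_))
    ext i
    refine Fin.cases ?_ (fun j => ?_) i <;> simp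

/-- The Prékopa–Leindler inequality for the standard Gaussian measure. -/
theorem prekopa_leindler_stdGaussian {E : Type*} [NormedAddCommGroup E] [InnerProductSpace ℝ E]
    [FiniteDimensional ℝ E] [MeasurableSpace E] [BorelSpace E] {f g h : E → ℝ≥0∞} {a b : ℝ}
    (ha : 0 < a) (hb : 0 < b) (hab : a + b = 1)
    (hf : Measurable f) (hg : Measurable g) (hh : Measurable h)
    (hf1 : ∀ x, f x ≤ 1) (hg1 : ∀ x, g x ≤ 1)
    (H : ∀ x y, f x ^ a * g y ^ b ≤ h (a • x + b • y)) :
    (∫⁻ x, f x ∂stdGaussian E) ^ a * (∫⁻ x, g x ∂stdGaussian E) ^ b ≤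
      ∫⁻ x, h x ∂stdGaussian E := by
  have hT : Measurable fun x : Fin (Module.finrank ℝ E) → ℝ =>
      ∑ i, x i • stdOrthonormalBasis ℝ E i := by fun_prop
  rw [stdGaussian, lintegral_map hf hT, lintegral_map hg hT, lintegral_map hh hT]
  refine prekopa_leindler_pi ha hb hab (hf.comp hT) (hg.comp hT) (hh.comp hT) (fun x => hf1 _)
    (fun x => hg1 _) fun x y => (H _ _).trans (le_of_eq (congrArg h ?_))
  simp [add_smul, mul_smul, Finset.sum_add_distrib, Finset.smul_sum]

/-! ### Šidák's inequality -/

section Sidak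

variable {E : Type*} [NormedAddCommGroup E] [InnerProductSpace ℝ E]

/-- The central slab of half-width `c` orthogonal to `u`. -/
def slab (u : E) (c : ℝ) : Set E := {x | |inner ℝ u x| ≤ c}

theorem slab_eq_preimage (u : E) (c : ℝ) :
    slab u c = (fun x => inner ℝ u x) ⁻¹' Icc (-c) c := by
  ext x; simp [slab, abs_le]

theorem convex_slab (u : E) (c : ℝ) : Convex ℝ (slab u c) := by
  rw [slab_eq_preimage]
  exact (convex_Icc _ _).linear_preimage (innerSL ℝ u).toLinearMap

theorem neg_mem_slab {u : E} {c : ℝ} {x : E} (hx : x ∈ slab u c) : -x ∈ slab u c := by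
  simpa [slab] using hx

variable [FiniteDimensional ℝ E] [MeasurableSpace E] [BorelSpace E]

theorem hasGaussianLaw_id_stdGaussian : HasGaussianLaw (id : E → E) (stdGaussian E) := by
  have : IsGaussian ((stdGaussian E).map id) := by rw [Measure.map_id]; infer_instance
  exact IsGaussian.hasGaussianLaw

theorem covariance_inner_stdGaussian (u w : E) :
    cov[fun x => inner ℝ u x, fun x => inner ℝ w x; stdGaussian E] = inner ℝ u w := by
  rw [← covarianceBilin_apply_eq_cov IsGaussian.memLp_two_id, covarianceBilin_stdGaussian,
    innerSL_apply_apply]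

theorem map_inner_stdGaussian (u : E) :
    (stdGaussian E).map (fun x => inner ℝ u x) = gaussianReal 0 (‖u‖ ^ 2).toNNReal := by
  have h := IsGaussian.map_eq_gaussianReal (μ := stdGaussian E) (innerSL ℝ u)
  rw [integral_strongDual_stdGaussian, variance_dual_stdGaussian, innerSL_apply_norm] at h
  exact h

theorem measurableSet_slab (u : E) (c : ℝ) : MeasurableSet (slab u c) :=
  measurableSet_le (by fun_prop) measurable_const

/-- The Gaussian measure of a slab depends only on the length of the normal vector. -/
theorem stdGaussian_slab_congr {u w : E} (h : ‖u‖ = ‖w‖) (c : ℝ) :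
    stdGaussian E (slab u c) = stdGaussian E (slab w c) := by
  have key : ∀ v : E, stdGaussian E (slab v c) = gaussianReal 0 (‖v‖ ^ 2).toNNReal (Icc (-c) c) := by
    intro v
    rw [← map_inner_stdGaussian, Measure.map_apply (by fun_prop) measurableSet_Icc,
      slab_eq_preimage]
  rw [key, key, h]

/-- The two maps are jointly Gaussian and uncorrelated. -/
theorem indepFun_orthogonal_projection_stdGaussian {u : E} (hu : ‖u‖ = 1) :
    IndepFun (fun x : E => x - inner ℝ u x • u) (fun x => inner ℝ u x) (stdGaussian E) := by
  have hL : HasGaussianLaw (fun x : E => (x - inner ℝ u x • u, inner ℝ u x)) (stdGaussian E) :=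
    hasGaussianLaw_id_stdGaussian.map ((ContinuousLinearMap.id ℝ E - (innerSL ℝ u).smulRight u).prod (innerSL ℝ u))
  refine hL.indepFun_of_covariance_inner fun x t => ?_
  have h1 : (fun ω : E => inner ℝ x (ω - inner ℝ u ω • u)) =
      fun ω => inner ℝ (x - inner ℝ x u • u) ω := by
    ext ω
    simp [inner_sub_left, inner_sub_right, inner_smul_left, inner_smul_right]
    ring
  have h2 : (fun ω : E => inner ℝ t (inner ℝ u ω)) = fun ω => inner ℝ (t • u) ω := by
    ext ω
    simp [inner_smul_left, mul_comm]
  rw [h1, h2, covariance_inner_stdGaussian]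
  simp [inner_sub_left, inner_smul_left, inner_smul_right, hu]

/-- Disintegration of the Gaussian measure along a unit vector. -/
theorem stdGaussian_inter_slab_eq_lintegral {u : E} (hu : ‖u‖ = 1) {K : Set E}
    (hK : MeasurableSet K) {S : Set ℝ} (hS : MeasurableSet S) :
    stdGaussian E (K ∩ (fun x => inner ℝ u x) ⁻¹' S) =
      ∫⁻ t in S, stdGaussian E {x | (x - inner ℝ u x • u) + t • u ∈ K}
        ∂(stdGaussian E).map (fun x => inner ℝ u x) := by
  have hprod := (indepFun_iff_map_prod_eq_prod_map_map (by fun_prop) (by fun_prop)).1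
    (indepFun_orthogonal_projection_stdGaussian hu)
  have hadd : Measurable fun z : E × ℝ => z.1 + z.2 • u := by fun_prop
  set W : Set (E × ℝ) := {z | z.1 + z.2 • u ∈ K ∧ z.2 ∈ S} with hW
  have hWm : MeasurableSet W := (hadd hK).inter (measurable_snd hS)
  have hpre : K ∩ (fun x => inner ℝ u x) ⁻¹' S =
      (fun x : E => (x - inner ℝ u x • u, inner ℝ u x)) ⁻¹' W := by
    ext x; simp [hW]
  rw [hpre, ← Measure.map_apply (by fun_prop) hWm, hprod, Measure.prod_apply_symm hWm,
    ← lintegral_indicator hS]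
  refine lintegral_congr fun t => ?_
  rw [Measure.map_apply (by fun_prop) (hWm.preimage (by fun_prop))]
  by_cases ht : t ∈ S
  · simp [hW, ht]
  · simp [hW, ht]

/-- Sections of a symmetric convex set have smaller Gaussian measure further from the centre. -/
theorem stdGaussian_section_le {u : E} {K : Set E} (hK : MeasurableSet K) (hc : Convex ℝ K)
    (hs : ∀ x ∈ K, -x ∈ K) {s t : ℝ} (hst : |s| ≤ |t|) :
    stdGaussian E {x | (x - inner ℝ u x • u) + t • u ∈ K} ≤
      stdGaussian E {x | (x - inner ℝ u x • u) + s • u ∈ K} := by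
  set φ : ℝ → ℝ≥0∞ := fun t => stdGaussian E {x | (x - inner ℝ u x • u) + t • u ∈ K} with hφ
  have hm : ∀ t : ℝ, MeasurableSet {x | (x - inner ℝ u x • u) + t • u ∈ K} := fun t =>
    hK.preimage (by fun_prop)
  have heven : ∀ t, φ (-t) = φ t := by
    intro t
    have h := stdGaussian_map (LinearIsometryEquiv.neg ℝ (E := E))
    simp only [hφ]
    conv_lhs => rw [← h]
    rw [Measure.map_apply (LinearIsometryEquiv.neg ℝ (E := E)).continuous.measurable (hm _)]
    congr 1
    ext x
    have hx : -x - inner ℝ u (-x) • u + -t • u = -(x - inner ℝ u x • u + t • u) := by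
      simp only [inner_neg_right, neg_smul]; abel
    simp only [LinearIsometryEquiv.coe_neg, mem_preimage, mem_ofPred_eq, hx]
    exact ⟨fun h => by simpa using hs _ h, fun h => hs _ h⟩
  change φ t ≤ φ s
  rcases hst.lt_or_eq with hlt | heq
  swap
  · rcases abs_eq_abs.1 heq with rfl | rfl
    · exact le_rfl
    · rw [heven]
  wlog ht : 0 < t generalizing t
  · rw [← heven]
    rcases (not_lt.1 ht).lt_or_eq with h0 | rfl
    · exact this (by simpa using hst) (by simpa using hlt) (by linarith)
    · simp [(abs_nonneg s).not_gt] at hlt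
  rw [abs_of_pos ht, abs_lt] at hlt
  -- Weights writing `s` as a convex combination of `t` and `-t`; evenness then turns `φ t ^ a * φ
  -- (-t) ^ b` into `φ t`.
  have ha : 0 < (t + s) / (2 * t) := div_pos (by linarith) (by linarith)
  have hb : 0 < (t - s) / (2 * t) := div_pos (by linarith) (by linarith)
  have hab : (t + s) / (2 * t) + (t - s) / (2 * t) = 1 := by field_simp; ring
  have hs' : s = (t + s) / (2 * t) * t + (t - s) / (2 * t) * (-t) := by field_simp; ring
  set a := (t + s) / (2 * t)
  set b := (t - s) / (2 * t)
  have hi : ∀ t, ∫⁻ x, {x | (x - inner ℝ u x • u) + t • u ∈ K}.indicator 1 x ∂stdGaussian E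
      = φ t := fun t => lintegral_indicator_one (hm t)
  have h1 : ∀ (t : ℝ) (x : E),
      {x | (x - inner ℝ u x • u) + t • u ∈ K}.indicator (1 : E → ℝ≥0∞) x ≤ 1 := fun t x =>
    indicator_le_self' (by simp) x
  have key := prekopa_leindler_stdGaussian (E := E) ha hb hab
    (measurable_one.indicator (hm t)) (measurable_one.indicator (hm (-t)))
    (measurable_one.indicator (hm s)) (h1 t) (h1 (-t)) fun x y => ?_
  · rw [hi, hi, hi, heven] at key
    rcases eq_or_ne (φ t) 0 with h0 | h0
    · rw [h0]; exact zero_le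
    · rwa [← ENNReal.rpow_add _ _ h0 (measure_ne_top _ _), hab, ENNReal.rpow_one] at key
  · by_cases hx : (x - inner ℝ u x • u) + t • u ∈ K
    swap
    · simp [indicator, hx, ha]
    by_cases hy : (y - inner ℝ u y • u) + (-t) • u ∈ K
    swap
    · simp only [indicator, mem_ofPred_eq, hy, if_false, ENNReal.zero_rpow_of_pos hb, mul_zero]
      exact zero_le
    have hz : (a • x + b • y - inner ℝ u (a • x + b • y) • u) + s • u ∈ K := by
      convert hc hx hy ha.le hb.le hab using 1
      conv_lhs => rw [hs']
      simp only [inner_add_right, inner_smul_right]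
      module
    simp only [indicator, mem_ofPred_eq, hx, hy, hz, if_true, Pi.one_apply, ENNReal.one_rpow,
      mul_one, le_refl]

/-- The level `d` separates the values of `φ` on `S` from those off `S`, so the mean over `S` is at
least the overall mean. -/
theorem measure_mul_lintegral_le_setLIntegral {α : Type*} [MeasurableSpace α] (μ : Measure α)
    [IsProbabilityMeasure μ] {S : Set α} (hS : MeasurableSet S) {φ : α → ℝ≥0∞} {d : ℝ≥0∞}
    (h1 : ∀ x ∈ S, d ≤ φ x) (h2 : ∀ x ∉ S, φ x ≤ d) :
    (∫⁻ x, φ x ∂μ) * μ S ≤ ∫⁻ x in S, φ x ∂μ := by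
  have hA : d * μ S ≤ ∫⁻ x in S, φ x ∂μ := by
    rw [← setLIntegral_const]; exact setLIntegral_mono' hS h1
  have hB : ∫⁻ x in Sᶜ, φ x ∂μ ≤ d * μ Sᶜ := by
    rw [← setLIntegral_const]; exact setLIntegral_mono' hS.compl h2
  calc (∫⁻ x, φ x ∂μ) * μ S
      = (∫⁻ x in S, φ x ∂μ) * μ S + (∫⁻ x in Sᶜ, φ x ∂μ) * μ S := by
        rw [← lintegral_add_compl φ hS, add_mul]
    _ ≤ (∫⁻ x in S, φ x ∂μ) * μ S + (d * μ Sᶜ) * μ S := by gcongr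
    _ = (∫⁻ x in S, φ x ∂μ) * μ S + (d * μ S) * μ Sᶜ := by ring
    _ ≤ (∫⁻ x in S, φ x ∂μ) * μ S + (∫⁻ x in S, φ x ∂μ) * μ Sᶜ := by gcongr
    _ = ∫⁻ x in S, φ x ∂μ := by
        rw [← mul_add, measure_add_measure_compl hS, measure_univ, mul_one]

theorem stdGaussian_mul_slab_le_of_norm_eq_one {u : E} (hu : ‖u‖ = 1) {K : Set E}
    (hK : MeasurableSet K) (hc : Convex ℝ K) (hs : ∀ x ∈ K, -x ∈ K) (c : ℝ) :
    stdGaussian E K * stdGaussian E (slab u c) ≤ stdGaussian E (K ∩ slab u c) := by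
  rcases lt_or_ge c 0 with h0 | h0
  · have : slab u c = ∅ := eq_empty_of_forall_notMem fun x hx =>
      (h0.trans_le (abs_nonneg _)).not_ge hx
    simp [this]
  have hprob : IsProbabilityMeasure ((stdGaussian E).map fun x => inner ℝ u x) :=
    Measure.isProbabilityMeasure_map (by fun_prop)
  have h := stdGaussian_inter_slab_eq_lintegral hu hK MeasurableSet.univ
  rw [preimage_univ, inter_univ, setLIntegral_univ] at h
  rw [slab_eq_preimage, stdGaussian_inter_slab_eq_lintegral hu hK measurableSet_Icc, h,
    ← Measure.map_apply (by fun_prop) measurableSet_Icc]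
  refine measure_mul_lintegral_le_setLIntegral _ measurableSet_Icc
    (d := stdGaussian E {x | (x - inner ℝ u x • u) + c • u ∈ K}) (fun t ht => ?_) (fun t ht => ?_)
  · exact stdGaussian_section_le hK hc hs (by rw [abs_of_nonneg h0]; exact abs_le.2 ht)
  · refine stdGaussian_section_le hK hc hs ?_
    rw [abs_of_nonneg h0]
    exact (not_le.1 fun h => ht (abs_le.1 h)).le

/-- A symmetric convex set and a central slab are positively correlated under the standard
Gaussian measure. -/
theorem stdGaussian_mul_slab_le (v : E) {K : Set E}
    (hK : MeasurableSet K) (hc : Convex ℝ K) (hs : ∀ x ∈ K, -x ∈ K) (c : ℝ) :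
    stdGaussian E K * stdGaussian E (slab v c) ≤ stdGaussian E (K ∩ slab v c) := by
  rcases eq_or_ne v 0 with rfl | hv
  · rcases lt_or_ge c 0 with h0 | h0
    · simp [slab, h0.not_ge]
    · simp [slab, h0]
  have hv' : 0 < ‖v‖ := norm_pos_iff.2 hv
  have hslab : slab v c = slab (‖v‖⁻¹ • v) (‖v‖⁻¹ * c) := by
    ext x
    simp only [slab, mem_ofPred_eq, real_inner_smul_left, abs_mul, abs_inv, abs_norm]
    exact (mul_le_mul_iff_right₀ (inv_pos.2 hv')).symm
  rw [hslab]
  exact stdGaussian_mul_slab_le_of_norm_eq_one (by simp [norm_smul, hv'.ne']) hK hc hs _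

/-- Šidák's inequality. -/
theorem prod_stdGaussian_slab_le {ι : Type*} (s : Finset ι) (v : ι → E) (c : ι → ℝ) :
    ∏ i ∈ s, stdGaussian E (slab (v i) (c i)) ≤ stdGaussian E (⋂ i ∈ s, slab (v i) (c i)) := by
  classical
  induction s using Finset.induction_on with
  | empty => simp
  | insert j s hj ih =>
    rw [Finset.prod_insert hj, Finset.set_biInter_insert, inter_comm, mul_comm]
    refine (mul_le_mul_left ih _).trans (stdGaussian_mul_slab_le _ ?_ ?_ ?_ _)
    · exact s.measurableSet_biInter fun i _ => measurableSet_slab _ _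
    · exact convex_iInter₂ fun i _ => convex_slab _ _
    · intro x hx
      simp only [mem_iInter] at hx ⊢
      exact fun i hi => neg_mem_slab (hx i hi)

theorem stdGaussian_biInter_slab_of_orthogonal {ι : Type*} [Fintype ι] (w : ι → E)
    (hw : Pairwise fun i j => inner ℝ (w i) (w j) = 0) (c : ι → ℝ) :
    stdGaussian E (⋂ i ∈ Finset.univ, slab (w i) (c i)) =
      ∏ i, stdGaussian E (slab (w i) (c i)) := by
  have hL : HasGaussianLaw (fun (x : E) (i : ι) => (inner ℝ (w i) x : ℝ)) (stdGaussian E) :=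
    hasGaussianLaw_id_stdGaussian.map (ContinuousLinearMap.pi fun i => innerSL ℝ (w i))
  have hind := hL.iIndepFun_of_covariance_eq_zero (X := fun i (x : E) => (inner ℝ (w i) x : ℝ))
    fun i j hij => by rw [covariance_inner_stdGaussian]; exact hw hij
  have := hind.measure_inter_preimage_eq_mul Finset.univ
    (sets := fun i => Icc (-c i) (c i)) fun i _ => measurableSet_Icc
  simpa only [slab_eq_preimage] using this

/-- Among families with given lengths, orthogonal families minimize the Gaussian measure of
intersections of slabs. -/
theorem stdGaussian_biInter_slab_le {ι : Type*} [Fintype ι] {v w : ι → E}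
    (hvw : ∀ i, ‖w i‖ = ‖v i‖) (hw : Pairwise fun i j => inner ℝ (w i) (w j) = 0) (c : ι → ℝ) :
    stdGaussian E (⋂ i ∈ Finset.univ, slab (w i) (c i)) ≤
      stdGaussian E (⋂ i ∈ Finset.univ, slab (v i) (c i)) := by
  rw [stdGaussian_biInter_slab_of_orthogonal w hw,
    Finset.prod_congr rfl fun i _ => stdGaussian_slab_congr (hvw i) (c i)]
  exact prod_stdGaussian_slab_le _ _ _

end Sidak

/-! ### The Gaussian density -/

section Density

variable {E : Type*} [NormedAddCommGroup E] [InnerProductSpace ℝ E]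

variable (E) in
/-- The normalizing constant of the density `exp (-‖x‖²)`. -/
noncomputable def gaussNorm : ℝ := Real.pi ^ ((Module.finrank ℝ E : ℝ) / 2)

variable (E) in
theorem gaussNorm_pos : 0 < gaussNorm E := Real.rpow_pos_of_pos Real.pi_pos _

variable [FiniteDimensional ℝ E] [MeasurableSpace E] [BorelSpace E]

theorem integrable_exp_neg_norm_sq : Integrable fun x : E => Real.exp (-‖x‖ ^ 2) := by
  have h := (GaussianFourier.integrable_cexp_neg_mul_sq_norm_add (V := E) (b := 1) (by simp) 0 0).norm
  refine h.congr (Filter.Eventually.of_forall fun x => ?_)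
  simp [Complex.norm_exp, ← Complex.ofReal_pow]

variable (E) in
/-- The Gaussian probability measure with density proportional to `exp (-‖x‖²)`. -/
noncomputable def gaussMeasure : Measure E :=
  volume.withDensity fun x => ENNReal.ofReal ((gaussNorm E)⁻¹ * Real.exp (-‖x‖ ^ 2))

instance : IsFiniteMeasure (gaussMeasure E) :=
  isFiniteMeasure_withDensity_ofReal (integrable_exp_neg_norm_sq.const_mul _).2

theorem charFun_gaussMeasure (t : E) :
    charFun (gaussMeasure E) t = Complex.exp (-‖t‖ ^ 2 / 4) := by
  rw [charFun_apply, gaussMeasure, integral_withDensity_eq_integral_toReal_smul (by fun_prop)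
    (Filter.Eventually.of_forall fun x => ENNReal.ofReal_lt_top)]
  have hpos := gaussNorm_pos E
  have h := GaussianFourier.integral_cexp_neg_mul_sq_norm_add (V := E) (b := 1) (by simp) Complex.I t
  have hc : ((Real.pi : ℂ) / 1) ^ ((Module.finrank ℝ E : ℂ) / 2) = (gaussNorm E : ℂ) := by
    rw [gaussNorm, Complex.ofReal_cpow Real.pi_pos.le]
    simp
  rw [hc] at h
  calc ∫ x : E, (ENNReal.ofReal ((gaussNorm E)⁻¹ * Real.exp (-‖x‖ ^ 2))).toReal •
        Complex.exp (inner ℝ x t * Complex.I)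
      = ∫ x : E, (gaussNorm E : ℂ)⁻¹ *
          Complex.exp (-1 * ‖x‖ ^ 2 + Complex.I * (inner ℝ t x : ℝ)) := by
        refine integral_congr_ae (Filter.Eventually.of_forall fun x => ?_)
        simp only []
        rw [ENNReal.toReal_ofReal (by positivity), Complex.exp_add, real_inner_comm,
          Complex.real_smul]
        push_cast
        rw [mul_comm Complex.I, neg_one_mul, mul_assoc]
    _ = Complex.exp (-‖t‖ ^ 2 / 4) := by
        rw [integral_const_mul, h, ← mul_assoc, inv_mul_cancel₀ (by exact_mod_cast hpos.ne'),
          one_mul]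
        simp

/-- The density `exp (-‖x‖²)` has variance 1/2 in each direction, hence the factor `√2`. This
transfers the slab inequality and gives total mass one. -/
theorem map_smul_gaussMeasure : (gaussMeasure E).map (fun x => √2 • x) = stdGaussian E := by
  refine Measure.ext_of_charFun (funext fun t => ?_)
  rw [charFun_map_smul, charFun_gaussMeasure, charFun_stdGaussian, norm_smul, Real.norm_eq_abs,
    abs_of_nonneg (Real.sqrt_nonneg 2)]
  congr 1
  rw [Complex.ofReal_mul, mul_pow, ← Complex.ofReal_pow, Real.sq_sqrt (by norm_num)]
  push_cast
  ring

instance : IsProbabilityMeasure (gaussMeasure E) := by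
  refine ⟨?_⟩
  have h := measure_univ (μ := stdGaussian E)
  rwa [← map_smul_gaussMeasure, Measure.map_apply (by fun_prop) MeasurableSet.univ,
    preimage_univ] at h

theorem gaussMeasure_biInter_slab_le {ι : Type*} [Fintype ι] {v w : ι → E}
    (hvw : ∀ i, ‖w i‖ = ‖v i‖) (hw : Pairwise fun i j => inner ℝ (w i) (w j) = 0) (c : ι → ℝ) :
    gaussMeasure E (⋂ i, slab (w i) (c i)) ≤ gaussMeasure E (⋂ i, slab (v i) (c i)) := by
  have key : ∀ u : ι → E, gaussMeasure E (⋂ i, slab (u i) (c i)) =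
      stdGaussian E (⋂ i ∈ Finset.univ, slab (u i) (√2 * c i)) := by
    intro u
    rw [← map_smul_gaussMeasure, Measure.map_apply (by fun_prop)
      (Finset.measurableSet_biInter _ fun i _ => measurableSet_slab _ _)]
    congr 1
    ext x
    simp [slab, real_inner_smul_right, abs_mul, abs_of_nonneg (Real.sqrt_nonneg 2)]
  rw [key, key]
  exact stdGaussian_biInter_slab_le hvw hw _

end Density

/-! ### The functional `codeP` -/

section CodeP

variable {n : ℕ} {ι : Type*}

theorem maxGauss_nonneg (u : ι → EuclideanSpace ℝ (Fin n)) (x : EuclideanSpace ℝ (Fin n)) :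
    0 ≤ maxGauss u x :=
  Real.iSup_nonneg fun _ => (Real.exp_pos _).le

/-- The quotient of `maxGauss u x` by `exp (-‖x‖²)`. -/
noncomputable def relMaxGauss (u : ι → EuclideanSpace ℝ (Fin n)) (x : EuclideanSpace ℝ (Fin n)) : ℝ :=
  ⨆ i, Real.exp (2 * inner ℝ (u i) x - ‖u i‖ ^ 2)

theorem relMaxGauss_nonneg (u : ι → EuclideanSpace ℝ (Fin n)) (x : EuclideanSpace ℝ (Fin n)) :
    0 ≤ relMaxGauss u x :=
  Real.iSup_nonneg fun _ => (Real.exp_pos _).le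

theorem maxGauss_eq (u : ι → EuclideanSpace ℝ (Fin n)) (x : EuclideanSpace ℝ (Fin n)) :
    maxGauss u x = Real.exp (-‖x‖ ^ 2) * relMaxGauss u x := by
  rw [maxGauss, relMaxGauss, Real.mul_iSup_of_nonneg (Real.exp_pos _).le]
  refine iSup_congr fun i => ?_
  rw [← Real.exp_add, norm_sub_sq_real, real_inner_comm]
  ring_nf

variable [Finite ι]

theorem measurable_relMaxGauss (u : ι → EuclideanSpace ℝ (Fin n)) :
    Measurable (relMaxGauss u) :=
  Measurable.iSup fun i => by fun_prop

theorem measurable_maxGauss (u : ι → EuclideanSpace ℝ (Fin n)) : Measurable (maxGauss u) :=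
  Measurable.iSup fun i => by fun_prop

theorem integrable_maxGauss (u : ι → EuclideanSpace ℝ (Fin n)) : Integrable (maxGauss u) := by
  have := Fintype.ofFinite ι
  refine Integrable.mono' (g := fun x => ∑ i, Real.exp (-‖x - u i‖ ^ 2))
    (integrable_finsetSum _ fun i _ => integrable_exp_neg_norm_sq.comp_sub_right (u i))
    (measurable_maxGauss u).aestronglyMeasurable (Filter.Eventually.of_forall fun x => ?_)
  rw [Real.norm_of_nonneg (maxGauss_nonneg u x)]
  refine Real.iSup_le (fun i => ?_) (by positivity)
  exact Finset.single_le_sum (f := fun i => Real.exp (-‖x - u i‖ ^ 2))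
    (fun j _ => (Real.exp_pos _).le) (Finset.mem_univ i)

theorem lintegral_maxGauss_eq (u : ι → EuclideanSpace ℝ (Fin n)) :
    ∫⁻ x, ENNReal.ofReal (maxGauss u x) =
      ENNReal.ofReal (gaussNorm (EuclideanSpace ℝ (Fin n))) *
        ∫⁻ t in Ioi 0, gaussMeasure _ {x | t < relMaxGauss u x} := by
  have hpos := gaussNorm_pos (EuclideanSpace ℝ (Fin n))
  rw [← lintegral_eq_lintegral_meas_lt _ (Filter.Eventually.of_forall (relMaxGauss_nonneg u))
      (measurable_relMaxGauss u).aemeasurable, gaussMeasure,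
    lintegral_withDensity_eq_lintegral_mul _ (by fun_prop)
      (measurable_relMaxGauss u).ennreal_ofReal,
    ← lintegral_const_mul' _ _ ENNReal.ofReal_ne_top]
  refine lintegral_congr fun x => ?_
  rw [maxGauss_eq, Pi.mul_apply, ← ENNReal.ofReal_mul (by positivity),
    ← ENNReal.ofReal_mul hpos.le]
  congr 1
  field_simp

theorem codeP_eq (u : ι → EuclideanSpace ℝ (Fin n)) :
    codeP u = (∫⁻ x, ENNReal.ofReal (maxGauss u x)).toReal :=
  integral_eq_lintegral_of_nonneg_ae (Filter.Eventually.of_forall (maxGauss_nonneg u))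
    (measurable_maxGauss u).aestronglyMeasurable

theorem relMaxGauss_antipodal_le_iff {N : ℕ} (v : Fin N → EuclideanSpace ℝ (Fin n))
    {t : ℝ} (ht : 0 < t) (x : EuclideanSpace ℝ (Fin n)) :
    relMaxGauss (antipodal v) x ≤ t ↔
      x ∈ ⋂ i, slab (v i) ((Real.log t + ‖v i‖ ^ 2) / 2) := by
  have h1 : relMaxGauss (antipodal v) x ≤ t ↔
      ∀ i, Real.exp (2 * inner ℝ (antipodal v i) x - ‖antipodal v i‖ ^ 2) ≤ t :=
    -- For `N = 0` the supremum is the default value 0, so `0 ≤ t` is needed.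
    ⟨fun h i => (le_ciSup (Set.finite_range _).bddAbove i).trans h, fun h => Real.iSup_le h ht.le⟩
  rw [h1]
  simp only [← Real.le_log_iff_exp_le ht, Sum.forall, antipodal, Sum.elim_inl, Sum.elim_inr,
    norm_neg, inner_neg_left, mem_iInter, slab, mem_ofPred_eq, abs_le]
  rw [← forall_and]
  refine forall_congr' fun i => ⟨fun h => ⟨?_, ?_⟩, fun h => ⟨?_, ?_⟩⟩ <;> linarith [h.1, h.2]

theorem codeP_antipodal_le {N : ℕ} {v w : Fin N → EuclideanSpace ℝ (Fin n)}
    (hvw : ∀ i, ‖w i‖ = ‖v i‖) (hw : PairwiseOrthogonal w) :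
    codeP (antipodal v) ≤ codeP (antipodal w) := by
  rw [codeP_eq, codeP_eq]
  refine ENNReal.toReal_mono (integrable_maxGauss _).lintegral_lt_top.ne ?_
  rw [lintegral_maxGauss_eq, lintegral_maxGauss_eq]
  refine mul_le_mul_right (setLIntegral_mono' measurableSet_Ioi fun t ht => ?_) _
  have hcompl : ∀ u : Fin N → EuclideanSpace ℝ (Fin n),
      {x | t < relMaxGauss (antipodal u) x} =
        (⋂ i, slab (u i) ((Real.log t + ‖u i‖ ^ 2) / 2))ᶜ := by
    intro u
    ext x
    rw [mem_compl_iff, ← relMaxGauss_antipodal_le_iff u (mem_Ioi.1 ht) x, not_le]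
    rfl
  have hm : ∀ u : Fin N → EuclideanSpace ℝ (Fin n),
      MeasurableSet (⋂ i, slab (u i) ((Real.log t + ‖u i‖ ^ 2) / 2)) := fun u =>
    MeasurableSet.iInter fun i => measurableSet_slab _ _
  rw [hcompl, hcompl, prob_compl_eq_one_sub (hm v), prob_compl_eq_one_sub (hm w)]
  refine tsub_le_tsub_left ?_ 1
  -- Equal lengths give both intersections the same half-widths.
  simp only [← hvw]
  exact gaussMeasure_biInter_slab_le hvw hw _

end CodeP

theorem mainTheorem1 {n N : ℕ} (hN : N ≤ n) (r : Fin N → ℝ) (hr : ∀ i, 0 ≤ r i) :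
    (∀ v ∈ prescribedLengths n r, Integrable (maxGauss (antipodal v))) ∧
    (∃ w ∈ prescribedLengths n r, PairwiseOrthogonal w) ∧
    (∀ w ∈ prescribedLengths n r, PairwiseOrthogonal w →
      IsMaxOn (fun v => codeP (antipodal v)) (prescribedLengths n r) w) := by
  refine ⟨fun v _ => integrable_maxGauss _, ?_, fun w hw hwo v hv => ?_⟩
  · refine ⟨fun i => EuclideanSpace.single (Fin.castLE hN i) (r i), fun i => ?_, fun i j hij => ?_⟩
    · simp [abs_of_nonneg (hr i)]
    · have : Fin.castLE hN i ≠ Fin.castLE hN j := fun h => hij (Fin.castLE_injective hN h)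
      simp [this, EuclideanSpace.inner_single_left]
  · exact codeP_antipodal_le (fun i => (hw i).trans (hv i).symm) hwo
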